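/- Let $d\ge 3$ and $n\ge 0$ be integers and let $\mathcal{H}=\{0\}\times\mathbb{Z}^{d-1}\subset\mathbb{Z}^d$ be the hyperplane of sources. Let $(S_{z,i})_{z\in\mathcal{H},\,1\le i\le n}$ be independent simple symmetric random walks on $\mathbb{Z}^d$, where $S_{z,i}$ starts at $z$. Define random aggregates $A_n[0]\subset A_n[1]\subset\cdots\subset\mathbb{Z}^d$ as follows: start from the empty aggregate and, for $M=0,1,2,\dots$ in turn, send $n$ particles from each source $z\in\mathcal{H}$ with $\max_j|z_j|=M$, these sources being taken in lexicographical order. The $i$-th particle sent from $z$ follows $S_{z,i}$ up to the first site outside the current aggregate (possibly $z$ itself), and this site is added to the aggregate. $A_n[M]$ is the aggregate after all particles with $\max_j|z_j|\le M$ have been sent, and $A_n[\infty]=\bigcup_{M\ge 0}A_n[M]$, regarded as a random subset of $\mathbb{Z}^d$, that is, a random element of $\{0,1\}^{\mathbb{Z}^d}$ with the product $\sigma$-algebra. Then: 1. for every $k\in\mathcal{H}$, the set $T_kA_n[\infty]=\{x+k : x\in A_n[\infty]\}$ has the same law as $A_n[\infty]$; 2. for every $k'\in\tfrac12\mathcal{H}=\{h/2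 : h\in\mathcal{H}\}$, the set $S_{k'}A_n[\infty]=\{2k'-x : x\in A_n[\infty]\}$ has the same law as $A_n[\infty]$. -/

import Mathlib

open MeasureTheory ProbabilityTheory
open scoped ENNReal

namespace HyperplaneIDLA

/-- The lattice `ℤ^d`. -/
abbrev Lattice (d : ℕ) : Type := Fin d → ℤ

/-- The hyperplane of sources `{0} × ℤ^(d-1)`. -/
def hyperplane (d : ℕ) [NeZero d] : Set (Lattice d) := {z | z 0 = 0}

/-- The supremum norm `max_i |z_i|`, as a natural number. -/
def supNorm {d : ℕ} (z : Lattice d) : ℕ := Finset.univ.sup fun i => (z i).natAbs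

/-- Level `M`: the sources at sup-distance exactly `M` from the origin. -/
noncomputable def level (d : ℕ) [NeZero d] (M : ℕ) : Finset (Lattice d) :=
  (Fintype.piFinset fun _ => Finset.Icc (-(M : ℤ)) M).filter fun z => z 0 = 0 ∧ supNorm z = M

/-- The box used in `level` cuts off nothing. -/
theorem mem_level {d : ℕ} [NeZero d] {M : ℕ} {z : Lattice d} :
    z ∈ level d M ↔ z ∈ hyperplane d ∧ supNorm z = M := by
  constructor
  · intro h
    exact (Finset.mem_filter.1 h).2
  · intro h
    refine Finset.mem_filter.2 ⟨Fintype.mem_piFinset.2 fun i => ?_, h⟩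
    have h1 : (z i).natAbs ≤ supNorm z :=
      Finset.le_sup (f := fun i => (z i).natAbs) (Finset.mem_univ i)
    have h2 := h.2
    rw [Finset.mem_Icc]
    omega

/-- The sources of level `M`, listed in increasing lexicographical order. -/
noncomputable def levelList (d : ℕ) [NeZero d] (M : ℕ) : List (Lattice d) :=
  (((level d M).map toLex.toEmbedding).sort (· ≤ ·)).map ofLex

/-- The particles of level `M` in the order of emission: the sources in lexicographical order,
and `n` particles from each of them. The pair `(z, i)` is the `i`-th particle of source `z`. -/
noncomputable def particleList (d : ℕ) [NeZero d] (n M : ℕ) : List (Lattice d × Fin n) :=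
  (levelList d M).flatMap fun z => (List.finRange n).map fun i => (z, i)

/-- A particle following the trajectory `p` is sent when the aggregate is `A`: the first site
of `p` outside `A` is added to `A` (and nothing is added if `p` stays in `A` for ever). -/
def addParticle {d : ℕ} (A : Set (Lattice d)) (p : ℕ → Lattice d) : Set (Lattice d) :=
  A ∪ {x | ∃ t, p t = x ∧ p t ∉ A ∧ ∀ s < t, p s ∈ A}

/-- The aggregate obtained from `A` by sending the particles of level `M`, where `p z i` is the
trajectory of the `i`-th particle of source `z`. -/
noncomputable def addLevel {d n : ℕ} [NeZero d] (p : Lattice d → Fin n → ℕ → Lattice d)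
    (A : Set (Lattice d)) (M : ℕ) : Set (Lattice d) :=
  (particleList d n M).foldl (fun B q => addParticle B (p q.1 q.2)) A

/-- The aggregate `A_n[M]`, as a function of the trajectories. -/
noncomputable def aggregate {d n : ℕ} [NeZero d] (p : Lattice d → Fin n → ℕ → Lattice d) :
    ℕ → Set (Lattice d)
  | 0 => addLevel p ∅ 0
  | M + 1 => addLevel p (aggregate p M) (M + 1)

/-- The limiting aggregate `A_n[∞]`, the union of all `A_n[M]`. -/
noncomputable def limitAggregate {d n : ℕ} [NeZero d] (p : Lattice d → Fin n → ℕ → Lattice d) :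
    Set (Lattice d) :=
  ⋃ M, aggregate p M

/-- `X` is a simple symmetric random walk on `ℤ^d` started at `z`: its increments are independent
and uniform on the `2d` unit vectors. -/
structure IsSimpleRandomWalk {d : ℕ} {Ω : Type*} [MeasurableSpace Ω] (P : Measure Ω)
    (z : Lattice d) (X : ℕ → Ω → Lattice d) : Prop where
  measurable : ∀ t, Measurable (X t)
  start : ∀ᵐ ω ∂P, X 0 ω = z
  indep : iIndepFun (fun t ω => X (t + 1) ω - X t ω) P
  uniform : ∀ t (v : Lattice d), ∑ i, |v i| = 1 →
    P {ω | X (t + 1) ω - X t ω = v} = (2 * (d : ℝ≥0∞))⁻¹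

/-- The trajectories of the particles: for each source `z` and each `i < n` the process `S z i`
is a simple symmetric random walk started at `z`, and all these walks are independent.
Nothing is required of `S z i` when `z` is not a source; such values are never used. -/
structure IsWalkFamily {d n : ℕ} [NeZero d] {Ω : Type*} [MeasurableSpace Ω] (P : Measure Ω)
    (S : Lattice d → Fin n → ℕ → Ω → Lattice d) : Prop where
  walk : ∀ z ∈ hyperplane d, ∀ i, IsSimpleRandomWalk P z (S z i)
  indep : iIndepFun (fun (q : hyperplane d × Fin n) ω (t : ℕ) => S q.1 q.2 t ω) P

/-- The random set `A_n[∞]` built from the random trajectories `S`. -/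
noncomputable def randomAggregate {d n : ℕ} [NeZero d] {Ω : Type*}
    (S : Lattice d → Fin n → ℕ → Ω → Lattice d) (ω : Ω) : Set (Lattice d) :=
  limitAggregate fun z i t => S z i t ω

/-- The translate `T_k B`, where `T_k x = x + k`. -/
def translate {d : ℕ} (k : Lattice d) (B : Set (Lattice d)) : Set (Lattice d) :=
  (fun x => x + k) '' B

/-- The points of `½ℋ`, with rational coordinates. -/
def halfHyperplane (d : ℕ) [NeZero d] : Set (Fin d → ℚ) :=
  {c | ∃ h ∈ hyperplane d, ∀ i, c i = (h i : ℚ) / 2}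

/-- The image `S_c B` of a set of lattice points under the point reflection `S_c x = 2c - x`.
For `c ∈ ½ℋ` every `2c - x` is a lattice point. -/
def reflect {d : ℕ} (c : Fin d → ℚ) (B : Set (Lattice d)) : Set (Lattice d) :=
  {y | ∃ x ∈ B, ∀ i, (y i : ℚ) = 2 * c i - (x i : ℚ)}

end HyperplaneIDLA

/-! The law of a random set is determined by the probabilities that it contains given finite sets
`F`. For the limiting aggregate such a probability is the supremum over `M` of the same probability
for the finite aggregates, so only finite lists of sources and increasing events matter.

Sending one particle from `x` is encoded by the operator `sendOp` on functions of the aggregate,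
with a separate term for a particle that never settles, so that total mass is always 1. These
operators commute (`sendOp_comm`): if two particles would stop at the same site `a`, one settles and
the other restarts from `a`, whichever was sent first; all other cases are symmetric. Hence a finite
aggregate's law depends only on the multiset of sources, and extra sources, which may be sent last,
can only raise the probability of an increasing event (`sendListOp_le_of_subperm`).

A symmetry `σ` of the walk preserving the hyperplane carries the sources up to level `M` into those
up to some level `M'`. Therefore containing `F` is at most as likely for the image under `σ` as for
the aggregate itself; using `σ⁻¹` as well gives equality. Translations by `k` and reflections `x ↦ h
- x` are such symmetries. -/

namespace HyperplaneIDLA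

/-! ### Exit distributions of a Markov chain and the abelian property -/

section Chain

variable {E : Type*} (q : E → E → ℝ≥0∞)

/-- The probability that the Markov chain with transition function `q` started at `x` is at `y`
at time `t`, all its previous positions being in `A`. -/
noncomputable def stayProb (A : Set E) (x : E) : ℕ → E → ℝ≥0∞
  | 0, y => ({x} : Set E).indicator 1 y
  | t + 1, y => ∑' w, A.indicator (stayProb A x t) w * q w y

/-- The probability that the first position outside `A` of the chain started at `x` is `a`. -/
noncomputable def exitProb (A : Set E) (x : E) : E → ℝ≥0∞ :=
  Aᶜ.indicator fun a => ∑' t, stayProb q A x t a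

/-- The probability that the chain started at `x` stays in `A` for ever. -/
noncomputable def neverProb (A : Set E) (x : E) : ℝ≥0∞ := 1 - ∑' a, exitProb q A x a

/-- The transition operator of the aggregate when a particle is sent from `x`. -/
noncomputable def sendOp (x : E) (φ : Set E → ℝ≥0∞) (A : Set E) : ℝ≥0∞ :=
  ∑' a, exitProb q A x a * φ (insert a A) + neverProb q A x * φ A

variable {q}

/-- Markov property at the first visit to `a`: before it the path stays in `A`, after it a fresh
chain starts from `a`. The antidiagonal splits `t` into these two durations; the first term collects
the paths not yet at `a`. -/
theorem stayProb_insert {A : Set E} {a : E} (ha : a ∉ A) (x : E) (t : ℕ) (y : E) :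
    stayProb q (insert a A) x t y = ({a} : Set E)ᶜ.indicator (stayProb q A x t) y +
      ∑ p ∈ Finset.HasAntidiagonal.antidiagonal t, stayProb q A x p.1 a * stayProb q (insert a A) a p.2 y := by
  classical
  induction t generalizing y with
  | zero =>
    simp only [stayProb, Finset.Nat.antidiagonal_zero, Finset.sum_singleton, Set.indicator_apply,
      Set.mem_singleton_iff, Set.mem_compl_iff, Pi.one_apply]
    by_cases h : y = a <;> by_cases h' : a = x <;> simp [h, h', eq_comm]
    · aesop
  | succ t ih =>
    have h1 : ∀ w, (insert a A).indicator (stayProb q (insert a A) x t) w =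
        A.indicator (stayProb q A x t) w + ∑ p ∈ Finset.HasAntidiagonal.antidiagonal t, stayProb q A x p.1 a *
          (insert a A).indicator (stayProb q (insert a A) a p.2) w := by
      intro w
      by_cases hw : w ∈ insert a A
      · simp only [Set.indicator_of_mem hw, ih]
        congr 1
        rcases hw with rfl | hw
        · simp [ha]
        · have : w ≠ a := fun h => ha (h ▸ hw)
          simp [this, hw]
      · have : w ∉ A := fun h => hw (Or.inr h)
        simp [hw, this]
    -- The isolated term has no time left after the visit: the first visit to `a` is at time `t +
    -- 1`. It restores the value at `y = a` that the indicator removes.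
    rw [Finset.Nat.sum_antidiagonal_succ']
    simp only [stayProb, h1, add_mul, ENNReal.tsum_add, Finset.sum_mul]
    rw [Summable.tsum_finsetSum (fun _ _ => ENNReal.summable)]
    simp only [mul_assoc, ENNReal.tsum_mul_left]
    by_cases hy : y = a
    · subst hy
      simp
    · simp [hy]

theorem exitProb_of_mem {A : Set E} {a : E} (ha : a ∈ A) (x : E) : exitProb q A x a = 0 := by
  simp [exitProb, ha]

/-- The first-visit decomposition summed over all times: the convolution in time becomes a product.
-/
theorem exitProb_insert {A : Set E} {a : E} (ha : a ∉ A) (y b : E) :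
    exitProb q (insert a A) y b = ({a} : Set E)ᶜ.indicator (exitProb q A y) b +
      exitProb q A y a * exitProb q (insert a A) a b := by
  classical
  by_cases hb : b ∈ insert a A
  · rw [exitProb_of_mem hb, exitProb_of_mem hb]
    rcases hb with rfl | hb
    · simp
    · simp [Set.indicator_apply, exitProb_of_mem hb]
  · have hba : b ≠ a := fun h => hb (Or.inl h)
    have hbA : b ∉ A := fun h => hb (Or.inr h)
    simp only [exitProb, Set.indicator_of_mem (Set.mem_compl hb),
      Set.indicator_of_mem (Set.mem_compl hbA), Set.indicator_of_mem (Set.mem_compl ha),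
      Set.indicator_of_mem (show b ∈ ({a} : Set E)ᶜ from hba), stayProb_insert ha y _ b]
    rw [ENNReal.tsum_add]
    congr 1
    have h := (Finset.HasAntidiagonal.sigmaAntidiagonalEquivProd (A := ℕ)).tsum_eq
      fun p : ℕ × ℕ => stayProb q A y p.1 a * stayProb q (insert a A) a p.2 b
    rw [ENNReal.tsum_prod', ENNReal.tsum_sigma'] at h
    simp only [ENNReal.tsum_mul_left, ENNReal.tsum_mul_right] at h
    rw [← h]
    refine tsum_congr fun t => ?_
    rw [tsum_fintype]
    exact (Finset.sum_coe_sort (Finset.HasAntidiagonal.antidiagonal t)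
      (fun p => stayProb q A y p.1 a * stayProb q (insert a A) a p.2 b)).symm

/-- Conservation of mass: at each step the mass outside `A` is absorbed and the mass in `A` is
redistributed by `q` without loss. It follows that the subtraction in `neverProb` is not truncated.
-/
theorem sum_exit_add_stay (hq : ∀ x, ∑' y, q x y = 1) (A : Set E) (x : E) (t : ℕ) :
    ∑ s ∈ Finset.range t, ∑' a, Aᶜ.indicator (stayProb q A x s) a +
      ∑' a, stayProb q A x t a = 1 := by
  classical
  induction t with
  | zero =>
    simp only [stayProb, Finset.range_zero, Finset.sum_empty, zero_add]
    rw [tsum_eq_single x] <;> simp +contextual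
  | succ t ih =>
    rw [← ih, Finset.sum_range_succ, add_assoc]
    congr 1
    simp only [stayProb]
    rw [ENNReal.tsum_comm]
    simp only [ENNReal.tsum_mul_left, hq, mul_one]
    rw [← ENNReal.tsum_add]
    refine tsum_congr fun a => ?_
    rw [add_comm]
    exact congrFun (Set.indicator_self_add_compl A (stayProb q A x t)) a

theorem tsum_exitProb_le (hq : ∀ x, ∑' y, q x y = 1) (A : Set E) (x : E) :
    ∑' a, exitProb q A x a ≤ 1 := by
  classical
  have : ∀ a, exitProb q A x a = ∑' t, Aᶜ.indicator (stayProb q A x t) a := by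
    intro a
    by_cases ha : a ∈ A <;> simp [exitProb, ha]
  simp only [this]
  rw [ENNReal.tsum_comm, ENNReal.tsum_eq_iSup_nat]
  exact iSup_le fun t => le_self_add.trans (sum_exit_add_stay hq A x t).le

theorem tsum_exitProb_add_neverProb (hq : ∀ x, ∑' y, q x y = 1) (A : Set E) (x : E) :
    ∑' a, exitProb q A x a + neverProb q A x = 1 :=
  add_tsub_cancel_of_le (tsum_exitProb_le hq A x)

theorem neverProb_insert (hq : ∀ x, ∑' y, q x y = 1) {A : Set E} {a : E} (ha : a ∉ A) (y : E) :
    neverProb q (insert a A) y =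
      neverProb q A y + exitProb q A y a * neverProb q (insert a A) a := by
  classical
  have h1 := tsum_exitProb_add_neverProb hq (insert a A) y
  have hfin : ∑' b, exitProb q (insert a A) y b ≠ ∞ :=
    ((tsum_exitProb_le hq _ _).trans_lt ENNReal.one_lt_top).ne
  -- Both sides are completed to total mass 1 by adding the same finite exit mass, which avoids
  -- subtraction in `ℝ≥0∞`.
  refine (ENNReal.add_right_inj hfin).1 (h1.trans ?_)
  have h2 : ∑' b, exitProb q A y b =
      ∑' b, ({a} : Set E)ᶜ.indicator (exitProb q A y) b + exitProb q A y a := by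
    have : exitProb q A y a = ∑' b, ({a} : Set E).indicator (exitProb q A y) b := by
      rw [tsum_eq_single a] <;> simp +contextual
    conv_rhs => rw [this]
    rw [← ENNReal.tsum_add]
    refine tsum_congr fun b => ?_
    rw [add_comm]
    exact (congrFun (Set.indicator_self_add_compl {a} (exitProb q A y)) b).symm
  simp only [exitProb_insert ha y, ENNReal.tsum_add, ENNReal.tsum_mul_left]
  symm
  calc
    _ = ∑' b, ({a} : Set E)ᶜ.indicator (exitProb q A y) b + exitProb q A y a *
        (∑' b, exitProb q (insert a A) a b + neverProb q (insert a A) a) + neverProb q A y := by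
      ring
    _ = 1 := by
      rw [tsum_exitProb_add_neverProb hq (insert a A) a, mul_one, ← h2,
        tsum_exitProb_add_neverProb hq]

theorem sendOp_insert (hq : ∀ x, ∑' y, q x y = 1) {A : Set E} {a : E} (ha : a ∉ A) (y : E)
    (φ : Set E → ℝ≥0∞) :
    sendOp q y φ (insert a A) =
      ∑' b, ({a} : Set E)ᶜ.indicator (exitProb q A y) b * φ (insert b (insert a A)) +
        neverProb q A y * φ (insert a A) + exitProb q A y a * sendOp q a φ (insert a A) := by
  simp only [sendOp, exitProb_insert ha y, neverProb_insert hq ha y, add_mul, ENNReal.tsum_add,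
    mul_assoc, ENNReal.tsum_mul_left]
  ring

/-- The abelian property: the order in which two particles are sent does not matter. -/
theorem sendOp_comm (hq : ∀ x, ∑' y, q x y = 1) (x y : E) (φ : Set E → ℝ≥0∞) :
    sendOp q x (sendOp q y φ) = sendOp q y (sendOp q x φ) := by
  classical
  -- The four terms: distinct exit sites, exactly one particle settling, a common exit site `a`,
  -- neither particle settling. The diagonal is removed from the double sum because the third term
  -- accounts for it.
  have key : ∀ x y A, sendOp q x (sendOp q y φ) A =
      ∑' a, ∑' b, (if b = a then 0 else exitProb q A x a * exitProb q A y b) *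
        φ (insert b (insert a A)) +
      (neverProb q A y * ∑' a, exitProb q A x a * φ (insert a A) +
        neverProb q A x * ∑' a, exitProb q A y a * φ (insert a A)) +
      ∑' a, exitProb q A x a * exitProb q A y a * sendOp q a φ (insert a A) +
      neverProb q A x * neverProb q A y * φ A := by
    intro x y A
    have h1 : ∀ a, exitProb q A x a * sendOp q y φ (insert a A) =
        ∑' b, (if b = a then 0 else exitProb q A x a * exitProb q A y b) *
          φ (insert b (insert a A)) +
        neverProb q A y * (exitProb q A x a * φ (insert a A)) +
        exitProb q A x a * exitProb q A y a * sendOp q a φ (insert a A) := by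
      intro a
      by_cases ha : a ∈ A
      · simp [exitProb_of_mem ha]
      · rw [sendOp_insert hq ha, mul_add, mul_add, ← ENNReal.tsum_mul_left]
        congr 1
        · congr 1
          · refine tsum_congr fun b => ?_
            by_cases hb : b = a <;> simp [hb, mul_assoc]
          · ring
        · ring
    rw [sendOp]
    simp only [h1, ENNReal.tsum_add, ENNReal.tsum_mul_left]
    rw [sendOp]
    ring
  funext A
  rw [key x y, key y x, ENNReal.tsum_comm]
  congr 1
  · congr 1
    · congr 1
      · refine tsum_congr fun a => tsum_congr fun b => ?_
        rw [Set.insert_comm, mul_comm (exitProb q A x b)]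
        simp only [eq_comm]
      · ring
    · refine tsum_congr fun a => ?_
      ring
  · ring

theorem sendOp_mono (x : E) {φ ψ : Set E → ℝ≥0∞} (h : φ ≤ ψ) : sendOp q x φ ≤ sendOp q x ψ := by
  intro A
  unfold sendOp
  gcongr
  · exact h _
  · exact h _

theorem le_sendOp (hq : ∀ x, ∑' y, q x y = 1) (x : E) {φ : Set E → ℝ≥0∞} (hφ : Monotone φ) :
    φ ≤ sendOp q x φ := by
  intro A
  calc φ A = (∑' a, exitProb q A x a + neverProb q A x) * φ A := by
        rw [tsum_exitProb_add_neverProb hq, one_mul]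
    _ = ∑' a, exitProb q A x a * φ A + neverProb q A x * φ A := by
        rw [add_mul, ENNReal.tsum_mul_right]
    _ ≤ sendOp q x φ A := by
        unfold sendOp
        gcongr
        exact hφ (Set.subset_insert _ _)

variable (q) in
/-- The transition operator of the aggregate when particles are sent successively from the sources
in a list. -/
noncomputable def sendListOp (l : List E) (φ : Set E → ℝ≥0∞) : Set E → ℝ≥0∞ :=
  l.foldr (sendOp q) φ

theorem sendListOp_perm (hq : ∀ x, ∑' y, q x y = 1) {l l' : List E} (h : l.Perm l')
    (φ : Set E → ℝ≥0∞) : sendListOp q l φ = sendListOp q l' φ :=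
  haveI : LeftCommutative (sendOp q) := ⟨sendOp_comm hq⟩
  h.foldr_eq φ

theorem le_sendListOp (hq : ∀ x, ∑' y, q x y = 1) (l : List E) {φ : Set E → ℝ≥0∞}
    (hφ : Monotone φ) : φ ≤ sendListOp q l φ := by
  induction l with
  | nil => exact le_rfl
  | cons x l ih => exact (le_sendOp hq x hφ).trans (sendOp_mono x ih)

/-- By commutation the sources of `l'` missing from `l` can be sent last, and sending more particles
only increases the expectation of a monotone `φ`. -/
theorem sendListOp_le_of_subperm (hq : ∀ x, ∑' y, q x y = 1) {l l' : List E} (h : l.Subperm l')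
    {φ : Set E → ℝ≥0∞} (hφ : Monotone φ) : sendListOp q l φ ≤ sendListOp q l' φ := by
  obtain ⟨m, hm, hs⟩ := h
  obtain ⟨r, hr⟩ := hs.exists_perm_append
  rw [sendListOp_perm hq (hr.trans (hm.append_right r)), sendListOp, sendListOp, List.foldr_append]
  have := le_sendListOp hq r hφ
  clear hr hs hm
  induction l with
  | nil => exact this
  | cons x l ih => exact sendOp_mono x ih

/-! ### Equivariance under automorphisms of the chain -/

variable {σ : E ≃ E}

theorem stayProb_image (hσ : ∀ x y, q (σ x) (σ y) = q x y) (A : Set E) (x : E) (t : ℕ) (y : E) :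
    stayProb q (σ '' A) (σ x) t (σ y) = stayProb q A x t y := by
  classical
  induction t generalizing y with
  | zero => simp [stayProb, Set.indicator_apply]
  | succ t ih =>
    simp only [stayProb]
    rw [← σ.tsum_eq]
    refine tsum_congr fun w => ?_
    simp [Set.indicator_apply, ih, hσ]

theorem exitProb_image (hσ : ∀ x y, q (σ x) (σ y) = q x y) (A : Set E) (x a : E) :
    exitProb q (σ '' A) (σ x) (σ a) = exitProb q A x a := by
  classical
  simp [exitProb, Set.indicator_apply, stayProb_image hσ]

theorem sendOp_image (hσ : ∀ x y, q (σ x) (σ y) = q x y) (x : E) (φ : Set E → ℝ≥0∞) (A : Set E) :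
    sendOp q (σ x) φ (σ '' A) = sendOp q x (fun B => φ (σ '' B)) A := by
  have h : neverProb q (σ '' A) (σ x) = neverProb q A x := by
    rw [neverProb, neverProb, ← σ.tsum_eq]
    simp only [exitProb_image hσ]
  rw [sendOp, sendOp, h, ← σ.tsum_eq]
  simp only [exitProb_image hσ, Set.image_insert_eq]

theorem sendListOp_image (hσ : ∀ x y, q (σ x) (σ y) = q x y) (l : List E) (φ : Set E → ℝ≥0∞)
    (A : Set E) :
    sendListOp q (l.map σ) φ (σ '' A) = sendListOp q l (fun B => φ (σ '' B)) A := by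
  induction l generalizing A with
  | nil => rfl
  | cons x l ih =>
    have : (fun B => sendListOp q (l.map σ) φ (σ '' B)) =
        sendListOp q l (fun B => φ (σ '' B)) := funext ih
    simp only [List.map_cons, sendListOp, List.foldr_cons] at this ⊢
    rw [sendOp_image hσ, this]

end Chain

/-! ### The simple random walk and the law of finite aggregates -/

section Walk

/-- The law of the increments of the simple symmetric random walk. -/
noncomputable def stepLaw (d : ℕ) : Lattice d → ℝ≥0∞ :=
  {v : Lattice d | ∑ i, |v i| = 1}.indicator fun _ => (2 * (d : ℝ≥0∞))⁻¹

/-- The transition function of the simple symmetric random walk. -/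
noncomputable def stepKernel (d : ℕ) (x y : Lattice d) : ℝ≥0∞ := stepLaw d (y - x)

theorem range_single_units (d : ℕ) :
    Set.range (fun p : Fin d × ℤˣ => (Pi.single p.1 (p.2 : ℤ) : Lattice d)) =
      {v | ∑ i, |v i| = 1} := by
  ext v
  constructor
  · rintro ⟨⟨i, u⟩, rfl⟩
    have : ∀ j, |(Pi.single i (u : ℤ) : Lattice d) j| = if j = i then 1 else 0 := by
      intro j
      by_cases h : j = i
      · subst h; simpa using Int.isUnit_iff_abs_eq.1 u.isUnit
      · simp [h]
    simp [this]
  · intro hv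
    have hv : ∑ i, |v i| = 1 := hv
    obtain ⟨i, hi⟩ : ∃ i, v i ≠ 0 := by
      by_contra! h
      simp [h] at hv
    rw [← Finset.add_sum_erase _ _ (Finset.mem_univ i)] at hv
    have h0 : 0 ≤ ∑ j ∈ Finset.univ.erase i, |v j| := Finset.sum_nonneg fun _ _ => abs_nonneg _
    have h1 : 1 ≤ |v i| := Int.one_le_abs hi
    have h2 : ∑ j ∈ Finset.univ.erase i, |v j| = 0 := by omega
    rw [Finset.sum_eq_zero_iff_of_nonneg fun _ _ => abs_nonneg _] at h2
    have h3 : IsUnit (v i) := Int.isUnit_iff_abs_eq.2 (by omega)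
    refine ⟨(i, h3.unit), ?_⟩
    funext j
    by_cases h : j = i
    · subst h; simp
    · simpa [h] using (abs_eq_zero.1 (h2 j (by simp [h]))).symm

theorem tsum_stepLaw {d : ℕ} [NeZero d] : ∑' v, stepLaw d v = 1 := by
  have hinj : Function.Injective
      (fun p : Fin d × ℤˣ => (Pi.single p.1 (p.2 : ℤ) : Lattice d)) := by
    rintro ⟨i, u⟩ ⟨j, w⟩ h
    have h : (Pi.single i (u : ℤ) : Lattice d) = Pi.single j (w : ℤ) := h
    have hi := congrFun h i
    by_cases hij : i = j
    · subst hij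
      simpa [Units.ext_iff] using hi
    · simp [hij] at hi
  rw [stepLaw, ← range_single_units, ← tsum_subtype,
    tsum_range (fun _ => (2 * (d : ℝ≥0∞))⁻¹) hinj, tsum_fintype]
  have hd : (d : ℝ≥0∞) ≠ 0 := by exact_mod_cast NeZero.ne d
  simp only [Finset.sum_const, Finset.card_univ, Fintype.card_prod, Fintype.card_fin,
    Fintype.card_units_int, nsmul_eq_mul, Nat.cast_mul, Nat.cast_ofNat]
  rw [mul_comm (d : ℝ≥0∞)]
  exact ENNReal.mul_inv_cancel (mul_ne_zero two_ne_zero hd)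
    (ENNReal.mul_ne_top ENNReal.ofNat_ne_top (ENNReal.natCast_ne_top d))

theorem tsum_stepKernel {d : ℕ} [NeZero d] (x : Lattice d) : ∑' y, stepKernel d x y = 1 := by
  rw [← tsum_stepLaw (d := d), ← (Equiv.subRight x).tsum_eq (stepLaw d)]
  rfl

variable {Ω : Type*} [MeasurableSpace Ω] {P : Measure Ω}

namespace IsSimpleRandomWalk

variable {d : ℕ} {z : Lattice d} {X : ℕ → Ω → Lattice d}

theorem measurable_increment (hX : IsSimpleRandomWalk P z X) (t : ℕ) :
    Measurable fun ω => X (t + 1) ω - X t ω :=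
  (hX.measurable _).sub (hX.measurable _)

/-- The probabilities prescribed on the `2d` unit vectors already sum to 1, so no mass remains for
any other increment. -/
theorem measure_increment [NeZero d] [IsProbabilityMeasure P] (hX : IsSimpleRandomWalk P z X)
    (t : ℕ) (v : Lattice d) : P {ω | X (t + 1) ω - X t ω = v} = stepLaw d v := by
  have hle : ∀ v, stepLaw d v ≤ P {ω | X (t + 1) ω - X t ω = v} := by
    intro v
    by_cases hv : ∑ i, |v i| = 1
    · rw [hX.uniform t v hv]
      exact Set.indicator_le_self _ _ v
    · simp [stepLaw, hv]
  have hsum : ∑' v, P {ω | X (t + 1) ω - X t ω = v} = 1 := by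
    rw [← measure_iUnion]
    · rw [← measure_univ (μ := P)]
      congr 1
      ext ω
      simp
    · intro v w hvw
      exact Set.disjoint_left.2 fun ω h1 h2 => hvw (h1.symm.trans h2)
    · intro v
      exact hX.measurable_increment t (measurableSet_singleton v)
  refine le_antisymm ?_ (hle v)
  by_contra! h
  have := ENNReal.tsum_lt_tsum (by simp [tsum_stepLaw]) hle h
  rw [hsum, tsum_stepLaw] at this
  exact this.false

/-- The Markov property, in the form needed to compute exit distributions. -/
theorem measure_stay_inter_increment [NeZero d] [IsProbabilityMeasure P]
    (hX : IsSimpleRandomWalk P z X) (A : Set (Lattice d)) (t : ℕ) (w v : Lattice d) :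
    P ({ω | X t ω = w ∧ ∀ s < t, X s ω ∈ A} ∩ {ω | X (t + 1) ω - X t ω = v}) =
      P {ω | X t ω = w ∧ ∀ s < t, X s ω ∈ A} * stepLaw d v := by
  rw [← hX.measure_increment t v]
  -- `Y` agrees with `X` almost surely and, up to time `t`, is a function of the increments before
  -- `t` alone, which are independent of the next one.
  set Y : ℕ → Ω → Lattice d := fun s ω => z + ∑ i ∈ Finset.range s, (X (i + 1) ω - X i ω) with hY
  have hXY : ∀ᵐ ω ∂P, ∀ s, X s ω = Y s ω := by
    filter_upwards [hX.start] with ω hω s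
    simp only [hY, Finset.sum_range_sub (fun i => X i ω), hω]
    abel
  have hset : ({ω | X t ω = w ∧ ∀ s < t, X s ω ∈ A} : Set Ω) =ᵐ[P]
      {ω | Y t ω = w ∧ ∀ s < t, Y s ω ∈ A} := by
    filter_upwards [hXY] with ω hω
    apply propext
    change (X t ω = w ∧ ∀ s < t, X s ω ∈ A) ↔ (Y t ω = w ∧ ∀ s < t, Y s ω ∈ A)
    simp only [hω]
  have hset' := ae_eq_set_inter hset (ae_eq_refl {ω | X (t + 1) ω - X t ω = v})
  rw [measure_congr hset, measure_congr hset']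
  have hind := indep_iSup_of_disjoint
    (fun i => measurable_iff_comap_le.1 (hX.measurable_increment i)) hX.indep.iIndep
    (S := Set.Iio t) (T := {t}) (by simp)
  refine (Indep_iff _ _ _).1 hind _ _ ?_ ?_
  · set m : MeasurableSpace Ω := ⨆ i ∈ Set.Iio t, MeasurableSpace.comap
      (fun ω => X (i + 1) ω - X i ω) inferInstance
    have hm : ∀ s ≤ t, Measurable[m] (Y s) := by
      intro s hs
      refine Measurable.const_add (Finset.measurable_fun_sum _ fun i hi => ?_) z
      exact measurable_iff_comap_le.2 (le_iSup₂_of_le i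
        (lt_of_lt_of_le (Finset.mem_range.1 hi) hs) le_rfl)
    have : {ω | Y t ω = w ∧ ∀ s < t, Y s ω ∈ A} =
        Y t ⁻¹' {w} ∩ ⋂ s, ⋂ (_ : s < t), Y s ⁻¹' A := by
      ext ω; simp
    rw [this]
    refine MeasurableSet.inter (hm t le_rfl (measurableSet_singleton w)) ?_
    exact MeasurableSet.iInter fun s => MeasurableSet.iInter fun hs =>
      hm s hs.le (Set.to_countable A).measurableSet
  · exact (le_iSup₂_of_le (f := fun i (_ : i ∈ ({t} : Set ℕ)) => MeasurableSpace.comap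
      (fun ω => X (i + 1) ω - X i ω) inferInstance) t rfl le_rfl) _
      ⟨{v}, measurableSet_singleton v, rfl⟩

theorem measurableSet_stay (hX : IsSimpleRandomWalk P z X) (A : Set (Lattice d)) (t : ℕ)
    (y : Lattice d) : MeasurableSet {ω | X t ω = y ∧ ∀ s < t, X s ω ∈ A} := by
  have : {ω | X t ω = y ∧ ∀ s < t, X s ω ∈ A} = X t ⁻¹' {y} ∩ ⋂ s, ⋂ (_ : s < t), X s ⁻¹' A := by
    ext ω; simp
  rw [this]
  exact (hX.measurable t (measurableSet_singleton y)).inter <| MeasurableSet.iInter fun s =>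
    MeasurableSet.iInter fun _ => hX.measurable s (Set.to_countable A).measurableSet

theorem measure_stay [NeZero d] [IsProbabilityMeasure P] (hX : IsSimpleRandomWalk P z X)
    (A : Set (Lattice d)) (t : ℕ) (y : Lattice d) :
    P {ω | X t ω = y ∧ ∀ s < t, X s ω ∈ A} = stayProb (stepKernel d) A z t y := by
  classical
  induction t generalizing y with
  | zero =>
    by_cases h : y = z
    · have : ∀ᵐ ω ∂P, ω ∈ {ω | X 0 ω = y ∧ ∀ s < 0, X s ω ∈ A} := by
        filter_upwards [hX.start] with ω hω
        simp [hω, h]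
      rw [(mem_ae_iff_prob_eq_one (hX.measurableSet_stay A 0 y)).1 this]
      simp [stayProb, h]
    · have : P {ω | X 0 ω = y ∧ ∀ s < 0, X s ω ∈ A} = 0 := by
        rw [measure_eq_zero_iff_ae_notMem]
        filter_upwards [hX.start] with ω hω
        simp [hω, Ne.symm h]
      rw [this]
      simp [stayProb, h]
  | succ t ih =>
    have hset : {ω | X (t + 1) ω = y ∧ ∀ s < t + 1, X s ω ∈ A} =
        ⋃ w : A, {ω | X t ω = w ∧ ∀ s < t, X s ω ∈ A} ∩ {ω | X (t + 1) ω - X t ω = y - w} := by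
      ext ω
      simp only [Set.mem_ofPred_eq, Set.mem_iUnion, Set.mem_inter_iff, Nat.lt_succ_iff_lt_or_eq,
        or_imp, forall_and, forall_eq]
      constructor
      · rintro ⟨h1, h2, h3⟩
        exact ⟨⟨_, h3⟩, ⟨rfl, h2⟩, by rw [h1]⟩
      · rintro ⟨⟨w, hw⟩, ⟨h1, h2⟩, h3⟩
        have h1 : X t ω = w := h1
        rw [h1] at h3 ⊢
        exact ⟨sub_left_injective h3, h2, hw⟩
    rw [hset, measure_iUnion]
    · simp only [hX.measure_stay_inter_increment, ih, stayProb]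
      rw [tsum_subtype A (fun w => stayProb (stepKernel d) A z t w * stepLaw d (y - w))]
      refine tsum_congr fun w => ?_
      by_cases hw : w ∈ A <;> simp [hw, stepKernel]
    · rintro ⟨v, hv⟩ ⟨w, hw⟩ hvw
      refine Set.disjoint_left.2 fun ω h1 h2 => hvw (Subtype.ext ?_)
      exact h1.1.1.symm.trans h2.1.1
    · intro w
      exact (hX.measurableSet_stay A t w).inter
        (hX.measurable_increment t (measurableSet_singleton _))

end IsSimpleRandomWalk

/-- The trajectories whose first site outside `A` is `a`. -/
def exitSet {d : ℕ} (A : Set (Lattice d)) (a : Lattice d) : Set (ℕ → Lattice d) :=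
  {p | a ∉ A ∧ ∃ t, p t = a ∧ ∀ s < t, p s ∈ A}

variable {d : ℕ}

theorem disjoint_exitSet (A : Set (Lattice d)) : Pairwise (Function.onFun Disjoint (exitSet A)) := by
  intro a b hab
  refine Set.disjoint_left.2 ?_
  rintro p ⟨ha, t, hta, ht⟩ ⟨hb, u, hub, hu⟩
  rcases lt_trichotomy t u with h | rfl | h
  · exact ha (hta ▸ hu t h)
  · exact hab (hta.symm.trans hub)
  · exact hb (hub ▸ ht u h)

theorem addParticle_of_mem_exitSet {A : Set (Lattice d)} {a : Lattice d} {p : ℕ → Lattice d}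
    (hp : p ∈ exitSet A a) : addParticle A p = insert a A := by
  rw [addParticle, Set.union_comm, Set.insert_eq]
  congr 1
  ext x
  constructor
  · rintro ⟨u, rfl, hu, hs⟩
    by_contra h
    exact Set.disjoint_left.1 (disjoint_exitSet A h) ⟨hu, u, rfl, hs⟩ hp
  · rintro rfl
    obtain ⟨ha, t, rfl, ht⟩ := hp
    exact ⟨t, rfl, ha, ht⟩

theorem addParticle_of_notMem_exitSet {A : Set (Lattice d)} {p : ℕ → Lattice d}
    (hp : ∀ a, p ∉ exitSet A a) : addParticle A p = A := by
  rw [addParticle, Set.union_eq_left]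
  rintro x ⟨t, rfl, h, hs⟩
  exact absurd ⟨h, t, rfl, hs⟩ (hp (p t))

theorem measurableSet_exitSet (A : Set (Lattice d)) (a : Lattice d) :
    MeasurableSet (exitSet A a) := by
  by_cases ha : a ∈ A
  · have : exitSet A a = ∅ := by
      ext p
      simp [exitSet, ha]
    simp [this]
  · have : exitSet A a = ⋃ t, (fun p : ℕ → Lattice d => p t) ⁻¹' {a} ∩
        ⋂ s, ⋂ (_ : s < t), (fun p : ℕ → Lattice d => p s) ⁻¹' A := by
      ext p
      simp [exitSet, ha]
    rw [this]
    exact MeasurableSet.iUnion fun t =>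
      ((measurable_pi_apply t) (measurableSet_singleton a)).inter <|
      MeasurableSet.iInter fun s => MeasurableSet.iInter fun _ =>
        (measurable_pi_apply s) (Set.to_countable A).measurableSet

theorem IsSimpleRandomWalk.measure_exitSet [NeZero d] [IsProbabilityMeasure P] {z : Lattice d}
    {X : ℕ → Ω → Lattice d} (hX : IsSimpleRandomWalk P z X) (A : Set (Lattice d))
    (a : Lattice d) :
    P {ω | (fun t => X t ω) ∈ exitSet A a} = exitProb (stepKernel d) A z a := by
  by_cases ha : a ∈ A
  · simp [exitSet, ha, exitProb_of_mem ha]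
  · have : {ω | (fun t => X t ω) ∈ exitSet A a} =
        ⋃ t, {ω | X t ω = a ∧ ∀ s < t, X s ω ∈ A} := by
      ext ω
      simp [exitSet, ha]
    rw [this, measure_iUnion, exitProb, Set.indicator_of_mem (Set.mem_compl ha)]
    · simp only [hX.measure_stay]
    · intro t u htu
      refine Set.disjoint_left.2 ?_
      rintro ω ⟨ht, ht'⟩ ⟨hu, hu'⟩
      rcases lt_or_gt_of_ne htu with h | h
      · exact ha (ht ▸ hu' t h)
      · exact ha (hu ▸ ht' u h)
    · exact fun t => hX.measurableSet_stay A t a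

theorem measurable_addParticle {A : Ω → Set (Lattice d)} {p : Ω → ℕ → Lattice d}
    (hA : Measurable A) (hp : Measurable p) : Measurable fun ω => addParticle (A ω) (p ω) := by
  rw [measurable_set_iff]
  intro x
  have hA' : ∀ y, MeasurableSet {ω | y ∈ A ω} := fun y =>
    measurableSet_setOfPred.2 (measurable_set_iff.1 hA y)
  have hpt : ∀ t, Measurable fun ω => p ω t := fun t => measurable_pi_iff.1 hp t
  have hpA : ∀ t, MeasurableSet {ω | p ω t ∈ A ω} := by
    intro t
    have : {ω | p ω t ∈ A ω} = ⋃ y, (fun ω => p ω t) ⁻¹' {y} ∩ {ω | y ∈ A ω} := by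
      ext ω
      simp
    rw [this]
    exact MeasurableSet.iUnion fun y => (hpt t (measurableSet_singleton y)).inter (hA' y)
  refine measurableSet_setOfPred.1 ?_
  have : {ω | x ∈ addParticle (A ω) (p ω)} = {ω | x ∈ A ω} ∪ ⋃ t,
      ((fun ω => p ω t) ⁻¹' {x} ∩ {ω | p ω t ∈ A ω}ᶜ ∩ ⋂ s, ⋂ (_ : s < t), {ω | p ω s ∈ A ω}) := by
    ext ω
    simp [addParticle, and_assoc]
  rw [this]
  refine (hA' x).union (MeasurableSet.iUnion fun t => MeasurableSet.inter ?_ ?_)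
  · exact (hpt t (measurableSet_singleton x)).inter (hpA t).compl
  · exact MeasurableSet.iInter fun s => MeasurableSet.iInter fun _ => hpA s

theorem measurable_foldl_addParticle {ι : Type*} {X : ι → Ω → ℕ → Lattice d} {l : List ι}
    (hX : ∀ r ∈ l, Measurable (X r)) {A : Ω → Set (Lattice d)} (hA : Measurable A) :
    Measurable fun ω => l.foldl (fun B r => addParticle B (X r ω)) (A ω) := by
  induction l generalizing A with
  | nil => exact hA
  | cons r l ih =>
    simp only [List.foldl_cons]
    exact ih (fun r hr => hX r (List.mem_cons_of_mem _ hr))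
      (measurable_addParticle hA (hX r List.mem_cons_self))

/-- Splitting an event according to the site at which a particle settles. -/
theorem measure_eq_tsum_exitSet [IsFiniteMeasure P] {Y : Ω → ℕ → Lattice d} (hY : Measurable Y)
    (A : Set (Lattice d)) {D : Set Ω} (hD : MeasurableSet D) :
    P D = ∑' a, P (Y ⁻¹' exitSet A a ∩ D) + P ((⋃ a, Y ⁻¹' exitSet A a)ᶜ ∩ D) := by
  have hm : ∀ a, MeasurableSet (Y ⁻¹' exitSet A a) := fun a => hY (measurableSet_exitSet A a)
  rw [← measure_inter_add_sdiff D (MeasurableSet.iUnion hm), Set.inter_comm, Set.iUnion_inter,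
    measure_iUnion]
  · rw [Set.sdiff_eq, Set.inter_comm D]
  · intro a b hab
    exact ((disjoint_exitSet A hab).preimage Y).mono Set.inter_subset_left Set.inter_subset_left
  · exact fun a => (hm a).inter hD

/-- The law of the aggregate after finitely many particles, started from independent walks. -/
theorem IsWalkFamily.measure_foldl [NeZero d] [IsProbabilityMeasure P] {n : ℕ}
    {S : Lattice d → Fin n → ℕ → Ω → Lattice d} (hS : IsWalkFamily P S)
    {l : List (Lattice d × Fin n)} (hl : ∀ r ∈ l, r.1 ∈ hyperplane d) (hnd : l.Nodup)
    {C : Set (Set (Lattice d))} (hC : MeasurableSet C) (A : Set (Lattice d)) :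
    P {ω | l.foldl (fun B r => addParticle B fun t => S r.1 r.2 t ω) A ∈ C} =
      sendListOp (stepKernel d) (l.map Prod.fst) (C.indicator 1) A := by
  classical
  induction l generalizing A with
  | nil => by_cases h : A ∈ C <;> simp [sendListOp, h]
  | cons r l ih =>
    have hr := hl r List.mem_cons_self
    have hl' : ∀ r ∈ l, r.1 ∈ hyperplane d := fun r h => hl r (List.mem_cons_of_mem _ h)
    have hmeas : ∀ q : hyperplane d × Fin n, Measurable fun ω (t : ℕ) => S q.1 q.2 t ω :=
      fun q => measurable_pi_iff.2 fun t => (hS.walk q.1 q.1.2 q.2).measurable t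
    set r' : hyperplane d × Fin n := (⟨r.1, hr⟩, r.2)
    set Y : Ω → ℕ → Lattice d := fun ω t => S r.1 r.2 t ω with hYdef
    have hY : Measurable Y := hmeas r'
    set F : Set (Lattice d) → Ω → Set (Lattice d) := fun A ω =>
      l.foldl (fun B r => addParticle B fun t => S r.1 r.2 t ω) A with hF
    -- The first walk is independent of all the later ones because no particle is listed twice.
    have hind := indep_iSup_of_disjoint (fun q => measurable_iff_comap_le.1 (hmeas q))
      hS.indep.iIndep (S := {r'}) (T := {q | ((q.1 : Lattice d), q.2) ∈ l})
      (Set.disjoint_singleton_left.2 (List.nodup_cons.1 hnd).1)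
    have hind' : ∀ B A', MeasurableSet B → P (Y ⁻¹' B ∩ F A' ⁻¹' C) =
        P (Y ⁻¹' B) * sendListOp (stepKernel d) (l.map Prod.fst) (C.indicator 1) A' := by
      intro B A' hB
      rw [← ih hl' (List.nodup_cons.1 hnd).2 A']
      refine (Indep_iff _ _ _).1 hind _ _ ?_ ?_
      · exact (le_iSup₂_of_le (f := fun q (_ : q ∈ ({r'} : Set (hyperplane d × Fin n))) =>
          MeasurableSpace.comap (fun ω (t : ℕ) => S q.1 q.2 t ω) inferInstance) r' rfl le_rfl) _
          ⟨B, hB, rfl⟩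
      · set m : MeasurableSpace Ω := ⨆ q ∈ {q : hyperplane d × Fin n | ((q.1 : Lattice d), q.2) ∈ l},
          MeasurableSpace.comap (fun ω (t : ℕ) => S q.1 q.2 t ω) inferInstance
        have : Measurable[m] (F A') := by
          refine measurable_foldl_addParticle (X := fun (r : Lattice d × Fin n) ω t => S r.1 r.2 t ω)
            (fun r hr => ?_) measurable_const
          exact measurable_iff_comap_le.2 (le_iSup₂_of_le
            (f := fun q (_ : q ∈ {q : hyperplane d × Fin n | ((q.1 : Lattice d), q.2) ∈ l}) =>
            MeasurableSpace.comap (fun ω (t : ℕ) => S q.1 q.2 t ω) inferInstance)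
            (⟨r.1, hl' r hr⟩, r.2) hr le_rfl)
        exact this hC
    have hD : MeasurableSet {ω | F (addParticle A (Y ω)) ω ∈ C} := by
      have : Measurable fun ω => F (addParticle A (Y ω)) ω :=
        measurable_foldl_addParticle (X := fun (r : Lattice d × Fin n) ω t => S r.1 r.2 t ω)
          (fun r hr => hmeas (⟨r.1, hl' r hr⟩, r.2)) (measurable_addParticle measurable_const hY)
      exact this hC
    have hexit : ∀ a, P (Y ⁻¹' exitSet A a) = exitProb (stepKernel d) A r.1 a :=
      fun a => (hS.walk r.1 hr r.2).measure_exitSet A a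
    have hU : MeasurableSet (⋃ a, Y ⁻¹' exitSet A a) :=
      MeasurableSet.iUnion fun a => hY (measurableSet_exitSet A a)
    have hnever : P (⋃ a, Y ⁻¹' exitSet A a)ᶜ = neverProb (stepKernel d) A r.1 := by
      rw [prob_compl_eq_one_sub hU, measure_iUnion, neverProb]
      · simp only [hexit]
      · exact fun a b hab => (disjoint_exitSet A hab).preimage Y
      · exact fun a => hY (measurableSet_exitSet A a)
    change P {ω | F (addParticle A (Y ω)) ω ∈ C} = sendOp (stepKernel d) r.1
      (sendListOp (stepKernel d) (l.map Prod.fst) (C.indicator 1)) A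
    -- Once the settling site of the first particle is fixed, the aggregate is a deterministic set,
    -- so the remaining particles contribute an independent factor given by the induction
    -- hypothesis.
    rw [measure_eq_tsum_exitSet hY A hD, sendOp]
    congr 1
    · refine tsum_congr fun a => ?_
      rw [← hexit, ← hind' _ _ (measurableSet_exitSet A a)]
      congr 1
      ext ω
      refine and_congr_right fun h => ?_
      change F (addParticle A (Y ω)) ω ∈ C ↔ F (insert a A) ω ∈ C
      rw [addParticle_of_mem_exitSet h]
    · rw [← hnever, ← Set.preimage_iUnion, ← Set.preimage_compl,
        ← hind' _ _ (MeasurableSet.iUnion fun a => measurableSet_exitSet A a).compl]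
      congr 1
      ext ω
      refine and_congr_right fun h => ?_
      change F (addParticle A (Y ω)) ω ∈ C ↔ F A ω ∈ C
      rw [addParticle_of_notMem_exitSet]
      simpa using h

end Walk

theorem subset_foldl_addParticle {d : ℕ} {ι : Type*} (X : ι → ℕ → Lattice d) (l : List ι)
    (A : Set (Lattice d)) : A ⊆ l.foldl (fun B r => addParticle B (X r)) A := by
  induction l generalizing A with
  | nil => exact subset_rfl
  | cons r l ih => exact Set.subset_union_left.trans (ih _)

/-! ### Order of emission and images of the sources -/

section EmissionList

variable {d n : ℕ} [NeZero d]

theorem mem_levelList {M : ℕ} {z : Lattice d} : z ∈ levelList d M ↔ z ∈ level d M := by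
  simp [levelList]

theorem nodup_levelList (M : ℕ) : (levelList d M).Nodup :=
  (Finset.sort_nodup _ _).map ofLex.injective

theorem mem_particleList {M : ℕ} {r : Lattice d × Fin n} :
    r ∈ particleList d n M ↔ r.1 ∈ level d M := by
  obtain ⟨z, i⟩ := r
  simp [particleList, mem_levelList]

theorem nodup_particleList (M : ℕ) : (particleList d n M).Nodup := by
  refine List.nodup_flatMap.2 ⟨fun z _ => (List.nodup_finRange n).map fun i j h => by simpa using h,
    (nodup_levelList M).imp fun hzw => ?_⟩
  simp [Function.onFun, List.disjoint_left, hzw.symm]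

/-- All particles up to level `M`, in the order of emission. -/
noncomputable def emissionList (d n : ℕ) [NeZero d] : ℕ → List (Lattice d × Fin n)
  | 0 => particleList d n 0
  | M + 1 => emissionList d n M ++ particleList d n (M + 1)

theorem mem_emissionList {M : ℕ} {r : Lattice d × Fin n} :
    r ∈ emissionList d n M ↔ r.1 ∈ hyperplane d ∧ supNorm r.1 ≤ M := by
  induction M with
  | zero => simp [emissionList, mem_particleList, mem_level]
  | succ M ih =>
    rw [emissionList, List.mem_append, ih, mem_particleList, mem_level, ← and_or_left]
    exact and_congr_right fun _ => by omega

theorem nodup_emissionList (M : ℕ) : (emissionList d n M).Nodup := by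
  induction M with
  | zero => exact nodup_particleList 0
  | succ M ih =>
    refine List.nodup_append'.2 ⟨ih, nodup_particleList _, fun r h1 h2 => ?_⟩
    have h1 := (mem_emissionList.1 h1).2
    have h2 := (mem_level.1 (mem_particleList.1 h2)).2
    omega

theorem aggregate_eq_foldl (p : Lattice d → Fin n → ℕ → Lattice d) (M : ℕ) :
    aggregate p M = (emissionList d n M).foldl (fun B r => addParticle B (p r.1 r.2)) ∅ := by
  induction M with
  | zero => rfl
  | succ M ih => rw [aggregate, ih, addLevel, emissionList, List.foldl_append]

theorem monotone_aggregate (p : Lattice d → Fin n → ℕ → Lattice d) : Monotone (aggregate p) :=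
  monotone_nat_of_le_succ fun _ =>
    subset_foldl_addParticle (fun r : Lattice d × Fin n => p r.1 r.2) _ _

theorem exists_emissionList_subperm {σ : Lattice d ≃ Lattice d}
    (hσ : ∀ z ∈ hyperplane d, σ z ∈ hyperplane d) (M : ℕ) :
    ∃ M', (((emissionList d n M).map Prod.fst).map σ).Subperm
      ((emissionList d n M').map Prod.fst) := by
  -- Keeping the particle index makes the moved list free of repetitions, so mere inclusion yields a
  -- sub-permutation; projecting to sources then gives the correct multiplicities.
  set l := (emissionList d n M).map (Prod.map σ id) with hl
  have hnd : l.Nodup :=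
    (nodup_emissionList M).map (Function.Injective.prodMap σ.injective Function.injective_id)
  refine ⟨l.toFinset.sup fun r => supNorm r.1, ?_⟩
  have hsub : l ⊆ emissionList d n (l.toFinset.sup fun r => supNorm r.1) := by
    intro r hr
    refine mem_emissionList.2 ⟨?_, Finset.le_sup (f := fun r : Lattice d × Fin n => supNorm r.1)
      (List.mem_toFinset.2 hr)⟩
    obtain ⟨r', hr', rfl⟩ := List.mem_map.1 hr
    exact hσ _ (mem_emissionList.1 hr').1
  obtain ⟨m, hm, hs⟩ := hnd.subperm hsub
  have : (l.map Prod.fst).Subperm _ := ⟨m.map Prod.fst, hm.map _, hs.map _⟩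
  rwa [hl, List.map_map, show (Prod.fst ∘ Prod.map σ id : Lattice d × Fin n → Lattice d) =
    σ ∘ Prod.fst from rfl, ← List.map_map] at this

end EmissionList

/-! ### Laws of random sets -/

section RandomSet

variable {α : Type*}

theorem measurableSet_finset_subset (F : Finset α) :
    MeasurableSet {A : Set α | (F : Set α) ⊆ A} := by
  have : {A : Set α | (F : Set α) ⊆ A} = ⋂ x ∈ F, {A | x ∈ A} := by
    ext A
    simp [Set.subset_def]
  rw [this]
  exact Finset.measurableSet_biInter _ fun x _ => measurableSet_mem x

/-- The law of a random set is determined by the probabilities that it contains given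
finite sets. -/
theorem measure_set_ext {μ ν : Measure (Set α)} [IsProbabilityMeasure μ] [IsProbabilityMeasure ν]
    (h : ∀ F : Finset α, μ {A | (F : Set α) ⊆ A} = ν {A | (F : Set α) ⊆ A}) : μ = ν := by
  classical
  refine ext_of_generate_finite (Set.range fun F : Finset α => {A : Set α | (F : Set α) ⊆ A})
    (le_antisymm ?_ ?_) ?_ ?_ (by simp)
  · set m := MeasurableSpace.generateFrom
      (Set.range fun F : Finset α => {A : Set α | (F : Set α) ⊆ A})
    have : @Measurable _ _ m Set.instMeasurableSpace (id : Set α → Set α) := by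
      refine (@measurable_set_iff _ _ m _).2 fun x => (@measurableSet_setOfPred _ m _).1 ?_
      exact MeasurableSpace.measurableSet_generateFrom ⟨{x}, by simp⟩
    exact fun s hs => this hs
  · refine MeasurableSpace.generateFrom_le ?_
    rintro _ ⟨F, rfl⟩
    exact measurableSet_finset_subset F
  -- The generating events form a π-system: containing `F` and `G` means containing `F ∪ G`.
  · rintro _ ⟨F, rfl⟩ _ ⟨G, rfl⟩ -
    refine ⟨F ∪ G, ?_⟩
    ext A
    simp
  · rintro _ ⟨F, rfl⟩
    exact h F

end RandomSet

/-! ### Symmetries of the limiting aggregate -/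

namespace IsWalkFamily

variable {d n : ℕ} [NeZero d] {Ω : Type*} [MeasurableSpace Ω] {P : Measure Ω}
  {S : Lattice d → Fin n → ℕ → Ω → Lattice d}

theorem measurable_aggregate (hS : IsWalkFamily P S) (M : ℕ) :
    Measurable fun ω => aggregate (fun z i t => S z i t ω) M := by
  simp only [aggregate_eq_foldl]
  refine measurable_foldl_addParticle (X := fun (r : Lattice d × Fin n) ω t => S r.1 r.2 t ω)
    (fun r hr => ?_) measurable_const
  exact measurable_pi_iff.2 fun t =>
    (hS.walk r.1 (mem_emissionList.1 hr).1 r.2).measurable t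

theorem measurable_randomAggregate (hS : IsWalkFamily P S) : Measurable (randomAggregate S) := by
  rw [measurable_set_iff]
  refine fun x => measurableSet_setOfPred.1 ?_
  have : {ω | x ∈ randomAggregate S ω} =
      ⋃ M, {ω | x ∈ aggregate (fun z i t => S z i t ω) M} := by
    ext ω
    simp [randomAggregate, limitAggregate]
  rw [this]
  exact MeasurableSet.iUnion fun M =>
    measurableSet_setOfPred.2 (measurable_set_iff.1 (hS.measurable_aggregate M) x)

/-- Inclusion probabilities of the limiting aggregate in terms of the finite aggregates. -/
theorem measure_subset_randomAggregate [IsProbabilityMeasure P] (hS : IsWalkFamily P S)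
    (F : Finset (Lattice d)) :
    P {ω | (F : Set (Lattice d)) ⊆ randomAggregate S ω} =
      ⨆ M, sendListOp (stepKernel d) ((emissionList d n M).map Prod.fst)
        ({A | (F : Set (Lattice d)) ⊆ A}.indicator 1) ∅ := by
  have hset : {ω | (F : Set (Lattice d)) ⊆ randomAggregate S ω} =
      ⋃ M, {ω | (F : Set (Lattice d)) ⊆ aggregate (fun z i t => S z i t ω) M} := by
    ext ω
    simp only [Set.mem_ofPred_eq, Set.mem_iUnion, randomAggregate, limitAggregate]
    constructor
    · intro h
      -- A finite set covered by an increasing union lies in one of its members.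
      exact (monotone_aggregate _).directed_le.exists_mem_subset_of_finset_subset_biUnion h
    · rintro ⟨M, hM⟩
      exact hM.trans (Set.subset_iUnion _ M)
  have hmono : Monotone fun M =>
      {ω | (F : Set (Lattice d)) ⊆ aggregate (fun z i t => S z i t ω) M} :=
    fun M N hMN ω h => Set.Subset.trans h (monotone_aggregate _ hMN)
  rw [hset, hmono.measure_iUnion]
  refine iSup_congr fun M => ?_
  rw [← hS.measure_foldl (fun r hr => (mem_emissionList.1 hr).1) (nodup_emissionList M)
    (measurableSet_finset_subset F)]
  simp only [aggregate_eq_foldl]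
  rfl

/-- By equivariance, the image under `σ` of a finite aggregate has the law of the aggregate grown
from the moved sources. These are among the sources up to a higher level, hence the inequality. -/
theorem measure_subset_image_le [IsProbabilityMeasure P] (hS : IsWalkFamily P S)
    {σ : Lattice d ≃ Lattice d} (hσ : ∀ x y, stepKernel d (σ x) (σ y) = stepKernel d x y)
    (hσH : ∀ z ∈ hyperplane d, σ z ∈ hyperplane d) (F : Finset (Lattice d)) :
    P {ω | (F : Set (Lattice d)) ⊆ σ '' randomAggregate S ω} ≤
      P {ω | (F : Set (Lattice d)) ⊆ randomAggregate S ω} := by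
  classical
  have hF : ∀ A : Set (Lattice d), (F : Set (Lattice d)) ⊆ σ '' A ↔
      ((F.map σ.symm.toEmbedding : Finset (Lattice d)) : Set (Lattice d)) ⊆ A := by
    intro A
    rw [Finset.coe_map, σ.image_eq_preimage_symm, Set.image_subset_iff]
    rfl
  have hmono : Monotone (({A | (F : Set (Lattice d)) ⊆ A} : Set (Set (Lattice d))).indicator
      (1 : Set (Lattice d) → ℝ≥0∞)) := by
    intro A B hAB
    by_cases h : (F : Set (Lattice d)) ⊆ A
    · have h' : (F : Set (Lattice d)) ⊆ B := h.trans hAB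
      simp [h, h']
    · simp [h]
  simp only [hF]
  rw [hS.measure_subset_randomAggregate, hS.measure_subset_randomAggregate]
  refine iSup_le fun M => ?_
  obtain ⟨M', hM'⟩ := exists_emissionList_subperm (n := n) hσH M
  refine le_trans (le_of_eq ?_) ((sendListOp_le_of_subperm tsum_stepKernel hM' hmono ∅).trans
    (le_iSup (fun M => sendListOp (stepKernel d) ((emissionList d n M).map Prod.fst)
        ({A | (F : Set (Lattice d)) ⊆ A}.indicator 1) ∅) M'))
  have := sendListOp_image hσ ((emissionList d n M).map Prod.fst)
    (({A | (F : Set (Lattice d)) ⊆ A} : Set (Set (Lattice d))).indicator 1) ∅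
  rw [Set.image_empty] at this
  rw [this]
  congr 1
  funext A
  simp only [Set.indicator_apply, Set.mem_ofPred_eq, hF, Pi.one_apply]

/-- The law of the limiting aggregate is invariant under every automorphism of the walk which
preserves the set of sources. -/
theorem identDistrib_image [IsProbabilityMeasure P] (hS : IsWalkFamily P S)
    {σ : Lattice d ≃ Lattice d} (hσ : ∀ x y, stepKernel d (σ x) (σ y) = stepKernel d x y)
    (hσH : ∀ z, σ z ∈ hyperplane d ↔ z ∈ hyperplane d) :
    IdentDistrib (fun ω => σ '' randomAggregate S ω) (randomAggregate S) P P := by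
  classical
  have hm := hS.measurable_randomAggregate
  have hm' : Measurable fun ω => σ '' randomAggregate S ω := by
    refine measurable_set_iff.2 fun x => ?_
    simp only [σ.image_eq_preimage_symm, Set.mem_preimage]
    exact measurable_set_iff.1 hm _
  refine ⟨hm'.aemeasurable, hm.aemeasurable, ?_⟩
  have := Measure.isProbabilityMeasure_map (μ := P) hm.aemeasurable
  have := Measure.isProbabilityMeasure_map (μ := P) hm'.aemeasurable
  refine measure_set_ext fun F => ?_
  rw [Measure.map_apply hm' (measurableSet_finset_subset F),
    Measure.map_apply hm (measurableSet_finset_subset F)]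
  refine le_antisymm (hS.measure_subset_image_le hσ (fun z => (hσH z).2) F) ?_
  have hsymm : ∀ x y, stepKernel d (σ.symm x) (σ.symm y) = stepKernel d x y := fun x y => by
    rw [← hσ, σ.apply_symm_apply, σ.apply_symm_apply]
  -- The inequality for `σ⁻¹` and the finite set `σ⁻¹ F` is the reverse of the one just used.
  have h := hS.measure_subset_image_le hsymm
    (fun z hz => (hσH _).1 (by rwa [σ.apply_symm_apply])) (F.map σ.symm.toEmbedding)
  have h1 : ∀ A : Set (Lattice d),
      ((F.map σ.symm.toEmbedding : Finset (Lattice d)) : Set (Lattice d)) ⊆ σ.symm '' A ↔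
        (F : Set (Lattice d)) ⊆ A := by
    intro A
    rw [Finset.coe_map]
    exact Set.image_subset_image_iff σ.symm.injective
  have h2 : ∀ A : Set (Lattice d),
      ((F.map σ.symm.toEmbedding : Finset (Lattice d)) : Set (Lattice d)) ⊆ A ↔
        (F : Set (Lattice d)) ⊆ σ '' A := by
    intro A
    rw [Finset.coe_map, σ.image_eq_preimage_symm, Set.image_subset_iff]
    rfl
  simp only [h1] at h
  simp only [h2] at h
  exact h

end IsWalkFamily

/-! ### Translations and point reflections -/

theorem stepLaw_neg {d : ℕ} (v : Lattice d) : stepLaw d (-v) = stepLaw d v := by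
  classical
  simp [stepLaw, Set.indicator_apply]

theorem translate_eq_image {d : ℕ} (k : Lattice d) (B : Set (Lattice d)) :
    translate k B = Equiv.addRight k '' B :=
  rfl

theorem reflect_eq_image {d : ℕ} {c : Fin d → ℚ} {h : Lattice d} (hc : ∀ i, c i = (h i : ℚ) / 2)
    (B : Set (Lattice d)) : reflect c B = Equiv.subLeft h '' B := by
  ext y
  have : ∀ x : Lattice d, (∀ i, (y i : ℚ) = 2 * c i - (x i : ℚ)) ↔ Equiv.subLeft h x = y := by
    intro x
    rw [funext_iff]
    refine forall_congr' fun i => ?_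
    rw [hc, mul_div_cancel₀ _ (two_ne_zero' ℚ), Equiv.subLeft_apply, Pi.sub_apply, eq_comm]
    norm_cast
  simp only [reflect, Set.mem_ofPred_eq, this, Set.mem_image]

end HyperplaneIDLA

theorem mainTheorem5 (d : ℕ) [NeZero d] (hd : 3 ≤ d) (n : ℕ)
    {Ω : Type*} [MeasurableSpace Ω] (P : Measure Ω) [IsProbabilityMeasure P]
    (S : HyperplaneIDLA.Lattice d → Fin n → ℕ → Ω → HyperplaneIDLA.Lattice d)
    (hS : HyperplaneIDLA.IsWalkFamily P S) :
    (∀ k ∈ HyperplaneIDLA.hyperplane d,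
      IdentDistrib (fun ω => HyperplaneIDLA.translate k (HyperplaneIDLA.randomAggregate S ω))
        (HyperplaneIDLA.randomAggregate S) P P) ∧
    (∀ c ∈ HyperplaneIDLA.halfHyperplane d,
      IdentDistrib (fun ω => HyperplaneIDLA.reflect c (HyperplaneIDLA.randomAggregate S ω))
        (HyperplaneIDLA.randomAggregate S) P P) := by
  constructor
  · intro k hk
    have hk : k 0 = 0 := hk
    simp only [HyperplaneIDLA.translate_eq_image]
    refine hS.identDistrib_image (fun x y => ?_) (fun z => ?_)
    · simp [HyperplaneIDLA.stepKernel]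
    · simp [HyperplaneIDLA.hyperplane, hk]
  · rintro c ⟨h, hh, hc⟩
    have hh : h 0 = 0 := hh
    simp only [HyperplaneIDLA.reflect_eq_image hc]
    refine hS.identDistrib_image (fun x y => ?_) (fun z => ?_)
    · simp only [HyperplaneIDLA.stepKernel, Equiv.subLeft_apply, sub_sub_sub_cancel_left]
      -- A point reflection reverses every increment, so the symmetry of the step law is what makes
      -- it an automorphism of the walk.
      rw [← HyperplaneIDLA.stepLaw_neg, neg_sub]
    · simp [HyperplaneIDLA.hyperplane, hh]
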